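/- Let $R$ be a valuation ring (a commutative integral domain in which, of any two elements, one divides the other) whose residue field $k$ is infinite. An $R$-algebra means an $R$-module $A$ with an $R$-bilinear multiplication $A\times A\to A$, not assumed associative, commutative or unital; put $Z(A)=\{x\in A\mid xA=Ax=\{0\}\}$. Let $(A_i)_{i\in I}$ be a family of $R$-algebras, $B$ an $R$-algebra that is torsion-free as an $R$-module, and $f:A=\prod_{i\in I}A_i\to B$ a surjective homomorphism of $R$-algebras. Let $\mathrm{rk}_R(B)$ be the rank of $B$, i.e. the common cardinality of all maximal $R$-linearly independent subsets of $B$. Suppose that either (i) $\mathrm{rk}_R(B)<\mathrm{card}(k)$, or (ii) $\mathrm{rk}_R(B)<2^{\aleph_0}$. Then the composite homomorphism $A\to B\to B/Z(B)$ can be factored, by homomorphisms of $R$-algebras, as $$A\to A/\mathcal U_0\times\dots\times A/\mathcal U_{n-1}\to B/Z(B)$$ for some $n\ge 0$, where the $\mathcal U_m$ are ultrafilters on $I$, which are $\mathrm{card}(k)^+$-complete in case (i) and countably complete (that is, $\aleph_1$-complete) in case (ii). Here $A/\mathcal U$ is the ultraproduct, i.e. the quotient of $A$ by the relation $\{i\mid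 a_i=b_i\}\in\mathcal U$, the first arrow is the product of the quotient maps, and a filter is called $\kappa$-complete if it is closed under intersections of fewer than $\kappa$ members. Call an infinite cardinal $\kappa$ measurable if there is a nonprincipal $\kappa$-complete ultrafilter on $\kappa$ (so $\aleph_0$ is measurable). If, in case (i), $\mathrm{card}(I)$ is less than every measurable cardinal $>\mathrm{card}(k)$, or, in case (ii), $\mathrm{card}(I)$ is less than every uncountable measurable cardinal, then there is a finite subset $J\subseteq I$ such that $A\to B\to B/Z(B)$ factors, by homomorphisms of $R$-algebras, through the projection $A\to\prod_{i\in J}A_i$, and such that $f=f_1+f_0$ for some $R$-algebra homomorphism $f_1:A\to B$ that factors through the same projection and some $R$-algebra homomorphism $f_0:A\to Z(B)$. -/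

import Mathlib

open Cardinal

universe u v w x

/-- A two-sided ideal of a (not necessarily associative, commutative or unital) `R`-algebra. -/
structure AlgIdeal (R : Type u) (A : Type v) [CommRing R] [NonUnitalNonAssocRing A]
    [Module R A] extends Submodule R A where
  mul_left_mem' : ∀ (a : A) {b : A}, b ∈ carrier → a * b ∈ carrier
  mul_right_mem' : ∀ {a : A} (b : A), a ∈ carrier → a * b ∈ carrier

namespace AlgIdeal

section Quotient

variable {R : Type u} {A : Type v} [CommRing R] [NonUnitalNonAssocRing A] [Module R A]

/-- The quotient algebra `A / J`. -/
def Quot (J : AlgIdeal R A) : Type v := A ⧸ J.toSubmodule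

instance (J : AlgIdeal R A) : AddCommGroup J.Quot :=
  inferInstanceAs (AddCommGroup (A ⧸ J.toSubmodule))

instance (J : AlgIdeal R A) : Module R J.Quot :=
  inferInstanceAs (Module R (A ⧸ J.toSubmodule))

/-- The quotient map, as an `R`-linear map. -/
def mkₗ (J : AlgIdeal R A) : A →ₗ[R] J.Quot := J.toSubmodule.mkQ

theorem mkₗ_surjective (J : AlgIdeal R A) : Function.Surjective J.mkₗ :=
  J.toSubmodule.mkQ_surjective

theorem mkₗ_eq_iff (J : AlgIdeal R A) (a b : A) :
    J.mkₗ a = J.mkₗ b ↔ a - b ∈ J.toSubmodule :=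
  Submodule.Quotient.eq J.toSubmodule

/-- Multiplication of cosets, induced by the multiplication of representatives. -/
instance (J : AlgIdeal R A) : Mul J.Quot where
  mul := Quotient.map₂ (· * ·) (by
    intro a a' ha b b' hb
    replace ha := (Submodule.quotientRel_def _).1 ha
    replace hb := (Submodule.quotientRel_def _).1 hb
    refine (Submodule.quotientRel_def _).2 ?_
    have h : a * b - a' * b' = (a - a') * b + a' * (b - b') := by
      rw [sub_mul, mul_sub]; abel
    rw [h]
    exact J.add_mem (J.mul_right_mem' b ha) (J.mul_left_mem' a' hb))

theorem mkₗ_mul (J : AlgIdeal R A) (a b : A) : J.mkₗ (a * b) = J.mkₗ a * J.mkₗ b := rfl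

instance (J : AlgIdeal R A) : NonUnitalNonAssocRing J.Quot where
  left_distrib p q r := by
    obtain ⟨a, rfl⟩ := J.mkₗ_surjective p
    obtain ⟨b, rfl⟩ := J.mkₗ_surjective q
    obtain ⟨c, rfl⟩ := J.mkₗ_surjective r
    simp only [← map_add, ← mkₗ_mul, mul_add]
  right_distrib p q r := by
    obtain ⟨a, rfl⟩ := J.mkₗ_surjective p
    obtain ⟨b, rfl⟩ := J.mkₗ_surjective q
    obtain ⟨c, rfl⟩ := J.mkₗ_surjective r
    simp only [← map_add, ← mkₗ_mul, add_mul]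
  zero_mul p := by
    obtain ⟨a, rfl⟩ := J.mkₗ_surjective p
    rw [← map_zero J.mkₗ, ← mkₗ_mul, zero_mul]
  mul_zero p := by
    obtain ⟨a, rfl⟩ := J.mkₗ_surjective p
    rw [← map_zero J.mkₗ, ← mkₗ_mul, mul_zero]

instance (J : AlgIdeal R A) [IsScalarTower R A A] : IsScalarTower R J.Quot J.Quot where
  smul_assoc r p q := by
    obtain ⟨a, rfl⟩ := J.mkₗ_surjective p
    obtain ⟨b, rfl⟩ := J.mkₗ_surjective q
    simp only [smul_eq_mul, ← map_smul, ← mkₗ_mul, smul_mul_assoc]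

instance (J : AlgIdeal R A) [SMulCommClass R A A] : SMulCommClass R J.Quot J.Quot where
  smul_comm r p q := by
    obtain ⟨a, rfl⟩ := J.mkₗ_surjective p
    obtain ⟨b, rfl⟩ := J.mkₗ_surjective q
    simp only [smul_eq_mul, ← map_smul, ← mkₗ_mul, mul_smul_comm]

/-- The quotient map `A → A / J`, as a homomorphism of `R`-algebras. -/
def quotMk (J : AlgIdeal R A) : A →ₙₐ[R] J.Quot where
  toFun := J.mkₗ
  map_smul' := J.mkₗ.map_smul
  map_zero' := J.mkₗ.map_zero
  map_add' := J.mkₗ.map_add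
  map_mul' := J.mkₗ_mul

end Quotient

end AlgIdeal

section Annihilator

variable (R : Type u) (B : Type v) [CommRing R] [NonUnitalNonAssocRing B] [Module R B]
  [IsScalarTower R B B] [SMulCommClass R B B]

/-- The total annihilator ideal `Z(B) = {x | xB = Bx = {0}}`. -/
def totalAnnihilator : AlgIdeal R B where
  carrier := {x | ∀ y : B, x * y = 0 ∧ y * x = 0}
  zero_mem' y := by simp
  add_mem' {a b} ha hb y := by
    simp [add_mul, mul_add, (ha y).1, (ha y).2, (hb y).1, (hb y).2]
  smul_mem' r a ha y := by
    simp [smul_mul_assoc, mul_smul_comm, (ha y).1, (ha y).2]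
  mul_left_mem' a b hb y := by
    simp [(hb a).2]
  mul_right_mem' {a} b ha y := by
    simp [(ha b).1]

/-- `Z(B)` as a subalgebra of `B`, hence as an algebra in its own right. -/
def totalAnnihilatorSubalgebra : NonUnitalSubalgebra R B where
  toSubmodule := (totalAnnihilator R B).toSubmodule
  mul_mem' {a _} _ hb := (totalAnnihilator R B).mul_left_mem' a hb

end Annihilator

section ReducedProduct

variable (R : Type u) {I : Type v} (A : I → Type w) [CommRing R]
  [∀ i, NonUnitalNonAssocRing (A i)] [∀ i, Module R (A i)]

/-- The ideal of those elements of `∏ i, A i` that vanish on a member of the filter `F`;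
thus `a ≡ b` modulo this ideal iff `{i | a i = b i} ∈ F`. -/
def reducedIdeal (F : Filter I) : AlgIdeal R (∀ i, A i) where
  carrier := {a | {i | a i = 0} ∈ F}
  zero_mem' := by simp
  add_mem' {a b} ha hb := by
    filter_upwards [ha, hb] with i hi hi'
    simp_all
  smul_mem' r a ha := by
    filter_upwards [ha] with i hi
    simp_all
  mul_left_mem' a b hb := by
    filter_upwards [hb] with i hi
    simp_all
  mul_right_mem' {a} b ha := by
    filter_upwards [ha] with i hi
    simp_all

/-- The ultraproduct `(∏ i, A i) / U`, as an `R`-algebra. -/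
abbrev Ultraproduct (U : Ultrafilter I) : Type (max v w) :=
  (reducedIdeal R A (U : Filter I)).Quot

/-- The quotient map from `∏ i, A i` to the ultraproduct. -/
abbrev Ultraproduct.mk (U : Ultrafilter I) : (∀ i, A i) →ₙₐ[R] Ultraproduct R A U :=
  (reducedIdeal R A (U : Filter I)).quotMk

end ReducedProduct

/-- A filter is `κ`-complete if it is closed under intersections of fewer than `κ` members.
(The cardinal `κ` may live in another universe than the index set.) -/
def Filter.IsCardComplete {I : Type v} (F : Filter I) (κ : Cardinal.{u}) : Prop :=
  ∀ S : Set (Set I), Cardinal.lift.{u} #S < Cardinal.lift.{v} κ → (∀ s ∈ S, s ∈ F) → ⋂₀ S ∈ F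

/-- An infinite cardinal `κ` is measurable if there is a nonprincipal `κ`-complete ultrafilter
on a set of cardinality `κ`. With this convention `ℵ₀` is measurable. -/
def Cardinal.IsMeasurableCard (κ : Cardinal.{v}) : Prop :=
  ℵ₀ ≤ κ ∧ ∃ U : Ultrafilter κ.out, (∀ i, U ≠ pure i) ∧ (U : Filter κ.out).IsCardComplete κ

section Factorization

variable {R : Type u} {I : Type v} {A : I → Type w} {B : Type x} [CommRing R]
  [∀ i, NonUnitalNonAssocRing (A i)] [∀ i, Module R (A i)]
  [NonUnitalNonAssocRing B] [Module R B] [IsScalarTower R B B] [SMulCommClass R B B]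

/-- The composite `∏ i, A i → B → B / Z(B)` factors, by algebra homomorphisms, as
`A → A/U₀ × ⋯ × A/Uₙ₋₁ → B / Z(B)` with `κ`-complete ultrafilters `U₀, …, Uₙ₋₁`. -/
def FactorsThroughUltraproducts (f : (∀ i, A i) →ₙₐ[R] B) (κ : Cardinal.{u}) : Prop :=
  ∃ (n : ℕ) (U : Fin n → Ultrafilter I),
    (∀ m, (U m : Filter I).IsCardComplete κ) ∧
    ∃ h : (∀ m, Ultraproduct R A (U m)) →ₙₐ[R] (totalAnnihilator R B).Quot,
      ∀ a, (totalAnnihilator R B).quotMk (f a) = h (fun m => Ultraproduct.mk R A (U m) a)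

/-- For some finite set `J` of indices, the composite `∏ i, A i → B → B / Z(B)` factors through
the projection to `∏ i ∈ J, A i`, and `f = f₁ + f₀` for algebra homomorphisms `f₁ : A → B` that
factors through the same projection, and `f₀ : A → Z(B)`. -/
def SplitsOverFiniteSubproduct (f : (∀ i, A i) →ₙₐ[R] B) : Prop :=
  ∃ J : Finset I,
    (∃ h : (∀ i : J, A i) →ₙₐ[R] (totalAnnihilator R B).Quot,
      ∀ a, (totalAnnihilator R B).quotMk (f a) = h (fun i => a i)) ∧
    ∃ (f₁ : (∀ i, A i) →ₙₐ[R] B) (f₀ : (∀ i, A i) →ₙₐ[R] totalAnnihilatorSubalgebra R B),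
      (∃ g : (∀ i : J, A i) →ₙₐ[R] B, ∀ a, f₁ a = g (fun i => a i)) ∧
      ∀ a, f a = f₁ a + (f₀ a : B)

end Factorization

/-!
Since `f (r • a) * f b = f a * f (r • b)` for all `r : I → R`, the kernel of the composite
`A → B → B / Z(B)` is stable under `R ^ I`. Consider any linear map `g` on `A = ∏ i, A i` with this
property, and the filter of those `S ⊆ I` such that `g` kills every family vanishing on `S`.

For a nonprincipal ultrafilter `U` on `T`, the ultrapower along `U` of the residue field `k` has
dimension at least `card k` if `T` embeds into `k`, and at least `2 ^ ℵ₀` if `T = ℕ`. A linear map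
from `R ^ T` to a torsion-free module of smaller rank therefore kills some `r` whose entries are
units `U`-almost everywhere. For the maps `r ↦ g ((r (π i) • a i)ᵢ)`, where `π : I → T` partitions
the index set, this gives `g a = 0` as soon as `a` is supported where the entries of `r ∘ π` are
units. It follows that only finitely many ultrafilters refine the filter of `g`, and that all of
them are complete. Finally `g` factors through the corresponding ultraproducts, which are factors
`A i` when there are no nonprincipal ultrafilters with this completeness.
-/

section Ultrafilters

open Filter

variable {I : Type v}

theorem disjoint_coe_ultrafilter_of_ne {U V : Ultrafilter I} (h : U ≠ V) :
    Disjoint (U : Filter I) V :=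
  U.disjoint_iff_not_le.2 fun hle => h (Ultrafilter.coe_le_coe.1 hle)

theorem exists_fibers_mem_of_infinite {𝒰 : Set (Ultrafilter I)} (h𝒰 : 𝒰.Infinite) :
    ∃ π : I → ℕ, ∀ n, ∃ U ∈ 𝒰, π ⁻¹' {n} ∈ U := by
  have := h𝒰.to_subtype
  obtain ⟨O, hinf, hopen, hdisj⟩ := exists_seq_infinite_isOpen_pairwise_disjoint 𝒰
  have hbasic : ∀ n, ∃ U : 𝒰, ∃ S, S ∈ U.1 ∧ ∀ V : 𝒰, S ∈ V.1 → V ∈ O n := fun n => by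
    obtain ⟨U, hU⟩ := (hinf n).nonempty
    obtain ⟨O', hO', hO⟩ := isOpen_induced_iff.1 (hopen n)
    obtain ⟨_, ⟨S, rfl⟩, hS, hSO'⟩ :=
      ultrafilterBasis_is_basis.exists_subset_of_mem_open (by rwa [← hO] at hU) hO'
    exact ⟨U, S, hS, fun V hV => hO ▸ hSO' hV⟩
  choose U S hSU hSO using hbasic
  have hnotMem : ∀ m n, m ≠ n → S m ∉ (U n).1 := fun m n hmn hS =>
    (hdisj hmn).le_bot ⟨hSO m _ hS, hSO n _ (hSU n)⟩
  refine ⟨fun i => sInf {n | i ∈ S n}, fun n => ⟨U n, (U n).2, ?_⟩⟩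
  have hfirst : ∀ᶠ i in ((U n : Ultrafilter I) : Filter I), ∀ m ∈ Finset.range n, i ∉ S m :=
    (eventually_all_finset _).2 fun m hm =>
      Ultrafilter.compl_mem_iff_notMem.2 (hnotMem m n (Finset.mem_range.1 hm).ne)
  filter_upwards [hSU n, hfirst] with i hi hlt
  have hmem : sInf {n | i ∈ S n} ∈ {n | i ∈ S n} := Nat.sInf_mem ⟨n, hi⟩
  exact (Nat.sInf_le hi).antisymm (not_lt.1 fun h => hlt _ (Finset.mem_range.2 h) hmem)

theorem exists_inf_principal_eq_of_finite {F : Filter I}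
    (hF : {V : Ultrafilter I | (V : Filter I) ≤ F}.Finite) {U : Ultrafilter I}
    (hU : (U : Filter I) ≤ F) : ∃ S, F ⊓ 𝓟 S = U := by
  obtain ⟨S, hS, hdisj⟩ := Set.PairwiseDisjoint.exists_mem_filter
    (l := fun V : Ultrafilter I => (V : Filter I))
    (fun _ _ _ _ hne => disjoint_coe_ultrafilter_of_ne hne) hF
  refine ⟨S U, le_antisymm (le_iff_ultrafilter.2 fun V hV => ?_)
    (le_inf hU (le_principal_iff.2 (hS U)))⟩
  obtain ⟨hVF, hVS⟩ := le_inf_iff.1 hV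
  by_contra hVU
  have hne : U ≠ V := by rintro rfl; exact hVU le_rfl
  have := inter_mem (hS V) (le_principal_iff.1 hVS)
  rw [(hdisj hVF hU hne.symm).inter_eq] at this
  exact V.empty_notMem this

theorem coe_map_le_cofinite_iff {T : Type*} {U : Ultrafilter I} {π : I → T} :
    (U.map π : Filter T) ≤ cofinite ↔ ∀ t, π ⁻¹' {t} ∉ U := by
  simp only [le_cofinite_iff_compl_singleton_mem, Ultrafilter.mem_coe, Ultrafilter.mem_map,
    Ultrafilter.compl_mem_iff_notMem]

theorem ne_pure_of_coe_le_cofinite {U : Ultrafilter I} (hU : (U : Filter I) ≤ cofinite) (i : I) :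
    U ≠ pure i := by
  rintro rfl
  exact le_cofinite_iff_compl_singleton_mem.1 hU i rfl

theorem isCardComplete_iff_forall_not_map_le_cofinite {U : Ultrafilter I} {κ : Cardinal.{u}} :
    (U : Filter I).IsCardComplete κ ↔ ∀ (T : Type v) (π : I → T),
      Cardinal.lift.{u} #T < Cardinal.lift.{v} κ → ¬ (U.map π : Filter T) ≤ cofinite := by
  refine ⟨fun hU T π hT hπ => ?_, fun hU 𝒮 h𝒮 hmem => ?_⟩
  · rw [coe_map_le_cofinite_iff] at hπ
    have hinter := hU (Set.range fun t => (π ⁻¹' {t})ᶜ)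
      ((Cardinal.lift_le.2 Cardinal.mk_range_le).trans_lt hT)
      (by rintro _ ⟨t, rfl⟩; exact Ultrafilter.compl_mem_iff_notMem.2 (hπ t))
    obtain ⟨i, hi⟩ := U.nonempty_of_mem hinter
    exact hi _ ⟨π i, rfl⟩ rfl
  · by_contra hinter
    have hmiss : ∀ᶠ i in (U : Filter I), ∃ s : 𝒮, i ∉ s.1 := by
      filter_upwards [Ultrafilter.compl_mem_iff_notMem.2 hinter] with i hi
      simpa using hi
    have : Nonempty 𝒮 := hmiss.exists.choose_spec.nonempty
    choose! π hπ using fun i (hi : ∃ s : 𝒮, i ∉ s.1) => hi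
    refine hU 𝒮 π h𝒮 (coe_map_le_cofinite_iff.2 fun s hs => ?_)
    obtain ⟨i, rfl, hi, his⟩ := U.nonempty_of_mem (inter_mem hs (inter_mem hmiss (hmem s s.2)))
    exact hπ i hi his

theorem isCardComplete_map {F : Filter I} {κ : Cardinal.{u}} (hF : F.IsCardComplete κ)
    {T : Type v} (π : I → T) : (F.map π).IsCardComplete κ := fun 𝒮 h𝒮 hmem => by
  rw [mem_map, Set.preimage_sInter, ← Set.sInter_image]
  exact hF _ ((Cardinal.lift_le.2 Cardinal.mk_image_le).trans_lt h𝒮) (Set.forall_mem_image.2 hmem)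

theorem isMeasurableCard_mk (hI : ℵ₀ ≤ #I) {U : Ultrafilter I} (hU : (U : Filter I) ≤ cofinite)
    (hc : (U : Filter I).IsCardComplete #I) : (#I).IsMeasurableCard := by
  refine ⟨hI, U.map Cardinal.outMkEquiv.symm, ?_, isCardComplete_map hc _⟩
  exact ne_pure_of_coe_le_cofinite
    ((map_mono hU).trans Cardinal.outMkEquiv.symm.injective.tendsto_cofinite)

theorem exists_isMeasurableCard_of_isCardComplete {U : Ultrafilter I}
    (hU : (U : Filter I) ≤ cofinite) {κ : Cardinal.{u}} (hκ : ℵ₀ ≤ κ)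
    (hc : (U : Filter I).IsCardComplete (Order.succ κ)) :
    ∃ μ : Cardinal.{v}, μ.IsMeasurableCard ∧
      Cardinal.lift.{v} κ < Cardinal.lift.{u} μ ∧ μ ≤ #I := by
  let 𝒞 : Set Cardinal.{v} := {c | ∃ (T : Type v) (π : I → T),
    (U.map π : Filter T) ≤ cofinite ∧ #T = c}
  have hI : #I ∈ 𝒞 := ⟨I, id, by simpa using hU, rfl⟩
  obtain ⟨T, π, hπ, hT⟩ : sInf 𝒞 ∈ 𝒞 := csInf_mem ⟨_, hI⟩
  have hlt : Cardinal.lift.{v} κ < Cardinal.lift.{u} #T := by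
    by_contra! hge
    refine isCardComplete_iff_forall_not_map_le_cofinite.1 hc T π ?_ hπ
    rwa [Cardinal.lift_succ, Order.lt_succ_iff]
  refine ⟨#T, isMeasurableCard_mk ?_ hπ ?_, hlt, hT ▸ csInf_le' hI⟩
  · exact Cardinal.aleph0_le_lift.1 ((Cardinal.aleph0_le_lift.2 hκ).trans hlt.le)
  · refine isCardComplete_iff_forall_not_map_le_cofinite.2 fun T' π' hT' hπ' => ?_
    rw [Cardinal.lift_lt, hT] at hT'
    exact notMem_of_lt_csInf' hT' ⟨T', π' ∘ π, by rwa [← Ultrafilter.map_map], rfl⟩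

end Ultrafilters

section Ultrapower

open Filter Polynomial

variable {T : Type v}

/-- A germ along `l` of functions `T → S`, for an `R`-algebra `S`, is multiplied by the scalars
of `R` pointwise; together with the ring structure of germs this makes `Germ l S` an
`R`-algebra. -/
noncomputable instance germAlgebra (R : Type*) {S : Type*} [CommSemiring R] [Semiring S]
    [Algebra R S] (l : Filter T) : Algebra R (Germ l S) :=
  Algebra.ofModule
    (fun r p q => Germ.inductionOn₂ p q fun g h => congrArg Germ.ofFun (smul_mul_assoc r g h))
    (fun r p q => Germ.inductionOn₂ p q fun g h => congrArg Germ.ofFun (mul_smul_comm r g h))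

/-- The quotient map from functions to germs, as an algebra homomorphism. -/
noncomputable def germAlgHom (R : Type*) {S : Type*} [CommSemiring R] [Semiring S]
    [Algebra R S] (l : Filter T) : (T → S) →ₐ[R] Germ l S :=
  AlgHom.mk' (Germ.coeRingHom l) fun _ _ => rfl

theorem transcendental_germ {k : Type u} [Field k] {l : Filter T} [l.NeBot] {g : T → k}
    (hg : Tendsto g l cofinite) : Transcendental k (g : Germ l k) := by
  refine transcendental_iff.2 fun p hp => ?_
  by_contra hp0
  have haeval : aeval (g : Germ l k) p = ((fun t => p.eval (g t) : T → k) : Germ l k) := by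
    refine (aeval_algHom_apply (germAlgHom k l) g p).trans (congrArg Germ.ofFun ?_)
    simpa only [coe_aeval_eq_eval] using aeval_pi_apply g p
  have hroot : ∀ᶠ t in l, p.eval (g t) = 0 := Germ.coe_eq.1 (haeval.symm.trans hp)
  have hnonroot : ∀ᶠ t in l, ¬ p.IsRoot (g t) :=
    hg.eventually (finite_setOfPred_isRoot hp0).eventually_cofinite_notMem
  obtain ⟨t, ht, ht'⟩ := (hroot.and hnonroot).exists
  exact ht' ht

theorem mk_le_rank_germ {k : Type u} [Field k] {U : Ultrafilter T} {g : T → k}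
    (hg : Tendsto g U cofinite) :
    Cardinal.lift.{v} #k ≤ Module.rank k (Germ (U : Filter T) k) := by
  have := (transcendental_germ hg).linearIndependent_sub_inv.cardinal_lift_le_rank
  rwa [Cardinal.lift_umax, Cardinal.lift_id'.{u, v}] at this

/-- Sequences in `{0, 1}` are coded by their finite initial segments; two distinct ones have only
finitely many initial segments in common. -/
theorem two_power_aleph0_le_mk_germ {l : Filter ℕ} [l.NeBot] (hl : l ≤ cofinite)
    (k : Type u) [Infinite k] : 2 ^ ℵ₀ ≤ #(Germ l k) := by
  let code : List Bool ↪ k := (Encodable.encode' _).trans (Infinite.natEmbedding k)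
  let G (x : ℕ → Bool) : Germ l k := (fun n => code ((List.range n).map x) : ℕ → k)
  have hG : Function.Injective G := fun x y hxy => by
    have hsegment : ∀ᶠ n in l, (List.range n).map x = (List.range n).map y :=
      (Germ.coe_eq.1 hxy).mono fun n hn => code.injective hn
    funext m
    have hlt : ∀ᶠ n in l, m < n := hl (by simpa [Nat.cofinite_eq_atTop] using eventually_gt_atTop m)
    obtain ⟨n, hn, hmn⟩ := (hsegment.and hlt).exists
    exact List.map_inj_left.1 hn m (List.mem_range.2 hmn)
  simpa using Cardinal.lift_mk_le_lift_mk_of_injective hG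

theorem two_power_aleph0_le_rank_germ {U : Ultrafilter ℕ} (hU : (U : Filter ℕ) ≤ cofinite)
    (k : Type u) [Field k] [Infinite k] :
    2 ^ ℵ₀ ≤ Module.rank k (Germ (U : Filter ℕ) k) := by
  rcases le_or_gt (2 ^ ℵ₀) #k with hk | hk
  · have hg : Tendsto (Infinite.natEmbedding k) U cofinite :=
      (Infinite.natEmbedding k).injective.tendsto_cofinite.mono_left hU
    simpa using hk.trans (by simpa using mk_le_rank_germ hg)
  · let b := Module.Free.chooseBasis k (Germ (U : Filter ℕ) k)
    have hcard := two_power_aleph0_le_mk_germ hU k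
    have := b.index_nonempty
    rw [Cardinal.mk_congr b.repr.toEquiv, mk_finsupp_of_infinite', b.mk_eq_rank'',
      le_max_iff] at hcard
    exact hcard.resolve_right hk.not_ge

end Ultrapower

section UnitKernel

open Filter IsLocalRing

theorem exists_forall_dvd_of_nonempty {M : Type*} [CommMonoid M] [PreValuationRing M] {ι : Type*}
    {s : Finset ι} (hs : s.Nonempty) (c : ι → M) : ∃ j ∈ s, ∀ i ∈ s, c j ∣ c i := by
  induction hs using Finset.Nonempty.cons_induction with
  | singleton a => exact ⟨a, by simp⟩
  | cons a s ha _ ih =>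
    obtain ⟨j, hj, hdvd⟩ := ih
    simp only [Finset.mem_cons, exists_eq_or_imp, forall_eq_or_imp]
    rcases ValuationRing.dvd_total (c a) (c j) with haj | hja
    · exact Or.inl ⟨dvd_rfl, fun i hi => haj.trans (hdvd i hi)⟩
    · exact Or.inr ⟨j, hj, hja, hdvd⟩

section Residue

variable {R : Type u} [CommRing R] [IsDomain R] [ValuationRing R]
  {M : Type*} [AddCommGroup M] [Module R M]
  {B : Type x} [AddCommGroup B] [Module R B] [Module.IsTorsionFree R B]
  {V : Type w} [AddCommGroup V] [Module (ResidueField R) V]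
  {φ : M →ₗ[R] B} {ρ : M →ₛₗ[residue R] V}

/-- Dividing a linear relation over `R` by a coefficient of least value turns it into a nontrivial
relation over the residue field. -/
theorem linearIndependent_of_residue (hker : ∀ y, φ y = 0 → ρ y = 0) {ι : Type*} {y : ι → M}
    (hy : LinearIndependent (ResidueField R) (ρ ∘ y)) : LinearIndependent R (φ ∘ y) := by
  refine linearIndependent_iff'.2 fun s c hc => ?_
  by_contra! hne
  obtain ⟨i₀, hi₀, hci₀⟩ := hne
  obtain ⟨j, hj, hdvd⟩ := exists_forall_dvd_of_nonempty ⟨i₀, hi₀⟩ c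
  have hcj : c j ≠ 0 := fun h => hci₀ (zero_dvd_iff.1 (h ▸ hdvd i₀ hi₀))
  choose! e he using hdvd
  have hej : e j = 1 := (mul_eq_left₀ hcj).1 (he j hj).symm
  have hφ : φ (∑ i ∈ s, e i • y i) = 0 := by
    refine (smul_eq_zero.1 ?_).resolve_left hcj
    rw [← hc, map_sum, Finset.smul_sum]
    refine Finset.sum_congr rfl fun i hi => ?_
    rw [map_smul, smul_smul, ← he i hi, Function.comp_apply]
  have hρ : ∑ i ∈ s, residue R (e i) • (ρ ∘ y) i = 0 := by
    simpa only [map_sum, map_smulₛₗ, Function.comp_apply] using hker _ hφ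
  have : residue R (e j) = 0 := linearIndependent_iff'.1 hy s _ hρ j hj
  rw [hej, map_one] at this
  exact one_ne_zero this

theorem rank_residue_le (hker : ∀ y, φ y = 0 → ρ y = 0) (hρ : Function.Surjective ρ) :
    Cardinal.lift.{x} (Module.rank (ResidueField R) V) ≤
      Cardinal.lift.{w} (Module.rank R B) := by
  let b := Module.Free.chooseBasis (ResidueField R) V
  choose y hy using fun j => hρ (b j)
  have hli : LinearIndependent R (φ ∘ y) := by
    refine linearIndependent_of_residue hker ?_
    rw [show ρ ∘ y = b from funext hy]
    exact b.linearIndependent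
  simpa only [b.mk_eq_rank''] using hli.cardinal_lift_le_rank

end Residue

/-- The reduction of a family of elements of a local ring `R` to the reduced power of the residue
field along `l`. -/
noncomputable def residueGerm (R : Type u) [CommRing R] [IsLocalRing R] {T : Type v}
    (l : Filter T) : (T → R) →ₛₗ[residue R] Germ l (ResidueField R) where
  toFun r := (fun t => residue R (r t) : T → ResidueField R)
  map_add' r s := congrArg Germ.ofFun (_root_.funext fun t => map_add (residue R) (r t) (s t))
  map_smul' c r := congrArg Germ.ofFun (_root_.funext fun t => map_mul (residue R) c (r t))

theorem residueGerm_surjective (R : Type u) [CommRing R] [IsLocalRing R] {T : Type v}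
    (l : Filter T) : Function.Surjective (residueGerm R l) := fun q =>
  q.inductionOn fun g => by
    choose r hr using fun t => residue_surjective (g t)
    exact ⟨r, congrArg Germ.ofFun (_root_.funext hr)⟩

theorem residueGerm_ne_zero_iff {R : Type u} [CommRing R] [IsLocalRing R] {T : Type v}
    {U : Ultrafilter T} {r : T → R} :
    residueGerm R (U : Filter T) r ≠ 0 ↔ {t | IsUnit (r t)} ∈ U := by
  refine (not_congr Germ.coe_eq).trans (Ultrafilter.eventually_not.symm.trans ?_)
  exact eventually_congr (.of_forall fun t => residue_ne_zero_iff_isUnit (r t))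

/-- Every linear map `R^T → B` kills, for each nonprincipal ultrafilter on `T`, a family that
consists of units almost everywhere. -/
def HasUnitKernel (R : Type u) (B : Type x) (T : Type v) [CommRing R] [AddCommGroup B]
    [Module R B] : Prop :=
  ∀ U : Ultrafilter T, (U : Filter T) ≤ cofinite → ∀ φ : (T → R) →ₗ[R] B,
    ∃ r, φ r = 0 ∧ {t | IsUnit (r t)} ∈ U

theorem HasUnitKernel.of_injective {R : Type u} {B : Type x} [CommRing R] [AddCommGroup B]
    [Module R B] {T : Type v} {T' : Type w} (h : HasUnitKernel R B T') {g : T → T'}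
    (hg : Function.Injective g) : HasUnitKernel R B T := fun U hU φ => by
  obtain ⟨r, hr, hunit⟩ :=
    h (U.map g) ((map_mono hU).trans hg.tendsto_cofinite) (φ ∘ₗ LinearMap.funLeft R R g)
  exact ⟨r ∘ g, hr, hunit⟩

variable {R : Type u} [CommRing R] [IsDomain R] [ValuationRing R]
  {B : Type x} [AddCommGroup B] [Module R B] [Module.IsTorsionFree R B]

theorem hasUnitKernel_of_rank_lt {T : Type v}
    (hrank : ∀ U : Ultrafilter T, (U : Filter T) ≤ cofinite →
      Cardinal.lift.{max u v} (Module.rank R B) <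
        Cardinal.lift.{x} (Module.rank (ResidueField R) (Germ (U : Filter T) (ResidueField R)))) :
    HasUnitKernel R B T := fun U hU φ => by
  by_contra! hno
  have hker : ∀ r, φ r = 0 → residueGerm R (U : Filter T) r = 0 := fun r hr =>
    not_not.1 fun h => hno r hr (residueGerm_ne_zero_iff.1 h)
  exact (hrank U hU).not_ge (rank_residue_le hker (residueGerm_surjective R _))

theorem hasUnitKernel_of_rank_lt_mk {T : Type v}
    (hrank : Cardinal.lift.{u} (Module.rank R B) < Cardinal.lift.{x} #(ResidueField R))
    (hT : Cardinal.lift.{u} #T ≤ Cardinal.lift.{v} #(ResidueField R)) :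
    HasUnitKernel R B T := by
  obtain ⟨g⟩ := Cardinal.lift_mk_le'.1 hT
  refine hasUnitKernel_of_rank_lt fun U hU => ?_
  have hmk := Cardinal.lift_le.{x}.2 (mk_le_rank_germ (g.injective.tendsto_cofinite.mono_left hU))
  refine LT.lt.trans_le ?_ hmk
  simpa only [Cardinal.lift_lift, Cardinal.lift_umax] using Cardinal.lift_lt.{_, v}.2 hrank

theorem hasUnitKernel_nat_of_rank_lt [Infinite (ResidueField R)]
    (hrank : Module.rank R B < 2 ^ ℵ₀) : HasUnitKernel R B ℕ := by
  refine hasUnitKernel_of_rank_lt fun U hU => ?_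
  have hmk := Cardinal.lift_le.{x}.2 (two_power_aleph0_le_rank_germ hU (ResidueField R))
  refine LT.lt.trans_le ?_ hmk
  simpa using Cardinal.lift_lt.{_, u}.2 hrank

end UnitKernel

section VanishingFilter

open Filter

variable {R : Type u} [CommRing R] {I : Type v} {A : I → Type w}
  [∀ i, AddCommGroup (A i)] [∀ i, Module R (A i)]
  {C : Type x} [AddCommGroup C] [Module R C]

/-- The filter of those sets `S` of indices such that `g` kills every family vanishing on `S`;
thus `g` factors through the restriction to `S`. -/
def vanishingFilter (g : (∀ i, A i) →ₗ[R] C) : Filter I where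
  sets := {S | ∀ a, (∀ i ∈ S, a i = 0) → g a = 0}
  univ_sets a ha := by rw [show a = 0 from funext fun i => ha i trivial, map_zero]
  sets_of_superset hS hST := by
    intro a ha
    exact hS a fun i hi => ha i (hST hi)
  inter_sets {S T} hS hT a ha := by
    classical
    rw [← sub_add_cancel a (S.piecewise 0 a), map_add, hT _ fun i hi => ?_,
      hS _ fun i hi => by simp [hi], add_zero]
    by_cases hiS : i ∈ S
    · simp [hiS, ha i ⟨hiS, hi⟩]
    · simp [hiS]

theorem mem_vanishingFilter {g : (∀ i, A i) →ₗ[R] C} {S : Set I} :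
    S ∈ vanishingFilter g ↔ ∀ a, (∀ i ∈ S, a i = 0) → g a = 0 := Iff.rfl

theorem map_eq_of_mem_vanishingFilter {g : (∀ i, A i) →ₗ[R] C} {a b : ∀ i, A i}
    (h : {i | a i = b i} ∈ vanishingFilter g) : g a = g b := by
  rw [← sub_eq_zero, ← map_sub]
  exact mem_vanishingFilter.1 h _ fun i hi => sub_eq_zero.2 hi

/-- The linear map `r ↦ g ((r (π i) • a i)ᵢ)` on `R^T`. -/
def weightedMap (g : (∀ i, A i) →ₗ[R] C) {T : Type*} (π : I → T) (a : ∀ i, A i) :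
    (T → R) →ₗ[R] C :=
  g ∘ₗ (LinearMap.toSpanSingleton (I → R) (∀ i, A i) a).restrictScalars R ∘ₗ LinearMap.funLeft R R π

theorem weightedMap_apply (g : (∀ i, A i) →ₗ[R] C) {T : Type*} (π : I → T) (a : ∀ i, A i)
    (r : T → R) : weightedMap g π a r = g ((r ∘ π) • a) := rfl

variable {g : (∀ i, A i) →ₗ[R] C}

theorem finite_ultrafilters_le_vanishingFilter (hg : ∀ a, g a = 0 → ∀ s : I → R, g (s • a) = 0)
    (hker : HasUnitKernel R C ℕ) :
    {U : Ultrafilter I | (U : Filter I) ≤ vanishingFilter g}.Finite := by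
  by_contra hinf
  obtain ⟨π, hπ⟩ := exists_fibers_mem_of_infinite hinf
  have hex : ∀ n, ∃ a, (∀ i, π i ≠ n → a i = 0) ∧ g a ≠ 0 := fun n => by
    obtain ⟨U, hU, hUn⟩ := hπ n
    by_contra! h
    exact Ultrafilter.compl_mem_iff_notMem.1 (hU (mem_vanishingFilter.2 h)) hUn
  choose a ha hga using hex
  obtain ⟨r, hr, hunit⟩ := hker (hyperfilter ℕ) hyperfilter_le_cofinite
    (weightedMap g π fun i => a (π i) i)
  obtain ⟨n, hn⟩ := Ultrafilter.nonempty_of_mem hunit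
  rw [weightedMap_apply] at hr
  refine hga n ?_
  rw [← hg _ hr (Pi.single n (Ring.inverse (r n)) ∘ π)]
  refine congrArg g (funext fun i => ?_)
  obtain rfl | hi := eq_or_ne (π i) n
  · simp [← mul_smul, Ring.inverse_mul_cancel _ hn]
  · simp [hi, ha n i hi]

theorem isCardComplete_of_le_vanishingFilter
    (hg : ∀ a, g a = 0 → ∀ s : I → R, g (s • a) = 0)
    (hfin : {U : Ultrafilter I | (U : Filter I) ≤ vanishingFilter g}.Finite) {κ : Cardinal.{u}}
    (hker : ∀ T : Type v, Cardinal.lift.{u} #T < Cardinal.lift.{v} κ → HasUnitKernel R C T)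
    {U : Ultrafilter I} (hU : (U : Filter I) ≤ vanishingFilter g) :
    (U : Filter I).IsCardComplete κ := by
  refine isCardComplete_iff_forall_not_map_le_cofinite.2 fun T π hT hπ => ?_
  obtain ⟨S, hS⟩ := exists_inf_principal_eq_of_finite hfin hU
  have hSU : S ∈ U := (hS ▸ inf_le_right : (U : Filter I) ≤ 𝓟 S) (mem_principal_self S)
  obtain ⟨a, ha, hga⟩ : ∃ a, (∀ i ∈ Sᶜ, a i = 0) ∧ g a ≠ 0 := by
    by_contra! h
    exact Ultrafilter.compl_mem_iff_notMem.1 (hU (mem_vanishingFilter.2 h)) hSU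
  obtain ⟨r, hr, hunit⟩ := hker T hT (U.map π) hπ (weightedMap g π a)
  have hlarge : ∀ᶠ i in vanishingFilter g, i ∈ S → IsUnit (r (π i)) := by
    rw [← eventually_inf_principal, hS]
    exact hunit
  rw [weightedMap_apply] at hr
  refine hga ?_
  rw [← hg _ hr (Ring.inverse ∘ r ∘ π)]
  refine map_eq_of_mem_vanishingFilter (hlarge.mono fun i hi => ?_)
  by_cases hiS : i ∈ S
  · simp [← mul_smul, Ring.inverse_mul_cancel _ (hi hiS)]
  · simp [ha i hiS]

end VanishingFilter

section ProductMaps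

variable {R : Type*} [CommRing R]

theorem exists_nonUnitalAlgHom_factor {P Q C : Type*}
    [NonUnitalNonAssocRing P] [Module R P] [NonUnitalNonAssocRing Q] [Module R Q]
    [NonUnitalNonAssocRing C] [Module R C] {ψ : P →ₙₐ[R] Q} (hψ : Function.Surjective ψ)
    {g : P →ₙₐ[R] C} (hker : ∀ p, ψ p = 0 → g p = 0) :
    ∃ h : Q →ₙₐ[R] C, ∀ p, g p = h (ψ p) := by
  choose σ hσ using hψ
  have hg : ∀ p, g (σ (ψ p)) = g p := fun p => by
    rw [← sub_eq_zero, ← map_sub]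
    exact hker _ (by rw [map_sub, hσ, sub_self])
  have hψ : Function.Surjective ψ := fun q => ⟨σ q, hσ q⟩
  refine ⟨{ toFun := fun q => g (σ q)
            map_smul' := fun r => hψ.forall.2 fun p => ?_
            map_zero' := ?_
            map_add' := hψ.forall₂.2 fun p p' => ?_
            map_mul' := hψ.forall₂.2 fun p p' => ?_ }, fun p => (hg p).symm⟩
  · rw [← map_smul, hg, hg]; exact map_smul g r p
  · rw [← map_zero ψ, hg, map_zero]
  · rw [← map_add, hg, hg, hg, map_add]
  · rw [← map_mul, hg, hg, hg, map_mul]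

variable {ι : Type*} {A : ι → Type*} [∀ i, NonUnitalNonAssocRing (A i)] [∀ i, Module R (A i)]

/-- The homomorphism of algebras into a product with given components. -/
def piLift {P : Type*} [NonUnitalNonAssocRing P] [Module R P] (g : ∀ i, P →ₙₐ[R] A i) :
    P →ₙₐ[R] ∀ i, A i where
  toFun p i := g i p
  map_smul' r p := funext fun i => map_smul (g i) r p
  map_zero' := funext fun i => map_zero (g i)
  map_add' p q := funext fun i => map_add (g i) p q
  map_mul' p q := funext fun i => map_mul (g i) p q

/-- The projection of a product of algebras to one of its factors. -/
def piEval (i : ι) : (∀ i, A i) →ₙₐ[R] A i where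
  toFun a := a i
  map_smul' _ _ := rfl
  map_zero' := rfl
  map_add' _ _ := rfl
  map_mul' _ _ := rfl

/-- The projection of a product of algebras to the subproduct over `S`, followed by extension by
zero to the full product. -/
noncomputable def piIndicator (S : Set ι) : (∀ i, A i) →ₙₐ[R] ∀ i, A i :=
  open Classical in piLift fun i => if i ∈ S then piEval i else 0

theorem piIndicator_apply_of_mem {S : Set ι} (a : ∀ i, A i) {i : ι} (hi : i ∈ S) :
    piIndicator (R := R) S a i = a i :=
  NonUnitalAlgHom.congr_fun (if_pos hi) a

theorem piIndicator_apply_of_notMem {S : Set ι} (a : ∀ i, A i) {i : ι} (hi : i ∉ S) :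
    piIndicator (R := R) S a i = 0 :=
  NonUnitalAlgHom.congr_fun (if_neg hi) a

theorem piIndicator_add_piIndicator_compl (S : Set ι) (a : ∀ i, A i) :
    piIndicator (R := R) S a + piIndicator (R := R) Sᶜ a = a := by
  funext i
  rw [Pi.add_apply]
  by_cases hi : i ∈ S
  · rw [piIndicator_apply_of_mem a hi, piIndicator_apply_of_notMem a (Set.notMem_compl_iff.2 hi),
      add_zero]
  · rw [piIndicator_apply_of_notMem a hi, piIndicator_apply_of_mem a hi, zero_add]

end ProductMaps

section Ultraproducts

open Filter

variable {R : Type u} {I : Type v} {A : I → Type w} [CommRing R]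
  [∀ i, NonUnitalNonAssocRing (A i)] [∀ i, Module R (A i)]

theorem AlgIdeal.quotMk_surjective {B : Type*} [NonUnitalNonAssocRing B] [Module R B]
    (J : AlgIdeal R B) : Function.Surjective J.quotMk := J.mkₗ_surjective

theorem AlgIdeal.quotMk_eq_zero_iff {B : Type*} [NonUnitalNonAssocRing B] [Module R B]
    {J : AlgIdeal R B} {b : B} : J.quotMk b = 0 ↔ b ∈ J.toSubmodule :=
  Submodule.Quotient.mk_eq_zero J.toSubmodule

theorem Ultraproduct.mk_eq_zero_iff {U : Ultrafilter I} {a : ∀ i, A i} :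
    Ultraproduct.mk R A U a = 0 ↔ ∀ᶠ i in (U : Filter I), a i = 0 :=
  AlgIdeal.quotMk_eq_zero_iff

theorem Ultraproduct.mk_eq_mk_of_eventually {U : Ultrafilter I} {a b : ∀ i, A i}
    (h : ∀ᶠ i in (U : Filter I), a i = b i) :
    Ultraproduct.mk R A U a = Ultraproduct.mk R A U b := by
  rw [← sub_eq_zero, ← map_sub, mk_eq_zero_iff]
  exact h.mono fun i hi => sub_eq_zero.2 hi

theorem Ultraproduct.piLift_mk_surjective {J : Type*} [Finite J] {U : J → Ultrafilter I}
    (hU : Function.Injective U) :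
    Function.Surjective (piLift fun j => Ultraproduct.mk R A (U j)) := fun q => by
  obtain ⟨S, hS, hdisj⟩ := Pairwise.exists_mem_filter_of_disjoint
    (l := fun j => (U j : Filter I)) fun j k hjk => disjoint_coe_ultrafilter_of_ne (hU.ne hjk)
  choose a ha using fun j => AlgIdeal.quotMk_surjective (reducedIdeal R A (U j : Filter I)) (q j)
  have hglue : ∀ i, ∃ x : A i, ∀ j, i ∈ S j → x = a j i := fun i => by
    by_cases hi : ∃ j, i ∈ S j
    · obtain ⟨j, hj⟩ := hi
      refine ⟨a j i, fun k hk => ?_⟩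
      rw [hdisj.eq (Set.not_disjoint_iff.2 ⟨i, hj, hk⟩)]
    · exact ⟨0, fun j hj => absurd ⟨j, hj⟩ hi⟩
  choose b hb using hglue
  refine ⟨b, funext fun j => ?_⟩
  rw [← ha j]
  exact mk_eq_mk_of_eventually (mem_of_superset (hS j) fun i hi => hb i j hi)

end Ultraproducts

section Quotient

open Filter

variable {R : Type u} [CommRing R] {B : Type x} [NonUnitalNonAssocRing B] [Module R B]
  [IsScalarTower R B B] [SMulCommClass R B B]

instance isTorsionFree_quot_totalAnnihilator [IsDomain R] [Module.IsTorsionFree R B] :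
    Module.IsTorsionFree R (totalAnnihilator R B).Quot := by
  refine .of_smul_eq_zero fun r q hrq => or_iff_not_imp_left.2 fun hr => ?_
  obtain ⟨b, rfl⟩ := AlgIdeal.quotMk_surjective _ q
  rw [← map_smul, AlgIdeal.quotMk_eq_zero_iff] at hrq
  refine AlgIdeal.quotMk_eq_zero_iff.2 fun y => ⟨?_, ?_⟩
  · exact (smul_eq_zero.1 ((smul_mul_assoc r b y).symm.trans (hrq y).1)).resolve_left hr
  · exact (smul_eq_zero.1 ((mul_smul_comm r y b).symm.trans (hrq y).2)).resolve_left hr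

variable {I : Type v} {A : I → Type w}
  [∀ i, NonUnitalNonAssocRing (A i)] [∀ i, Module R (A i)]

/-- The composite `∏ i, A i → B → B / Z(B)`, as a linear map. -/
def quotLinearMap (f : (∀ i, A i) →ₙₐ[R] B) : (∀ i, A i) →ₗ[R] (totalAnnihilator R B).Quot :=
  (totalAnnihilator R B).mkₗ ∘ₗ (f : (∀ i, A i) →ₗ[R] B)

theorem quotLinearMap_eq_zero_iff {f : (∀ i, A i) →ₙₐ[R] B} {a : ∀ i, A i} :
    quotLinearMap f a = 0 ↔ ∀ y, f a * y = 0 ∧ y * f a = 0 :=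
  AlgIdeal.quotMk_eq_zero_iff

theorem quotLinearMap_smul_eq_zero [∀ i, IsScalarTower R (A i) (A i)]
    [∀ i, SMulCommClass R (A i) (A i)] {f : (∀ i, A i) →ₙₐ[R] B} (hf : Function.Surjective f)
    {a : ∀ i, A i} (ha : quotLinearMap f a = 0) (s : I → R) : quotLinearMap f (s • a) = 0 := by
  rw [quotLinearMap_eq_zero_iff] at ha ⊢
  refine hf.forall.2 fun b => ⟨?_, ?_⟩
  · rw [← map_mul, smul_mul_assoc, ← mul_smul_comm, map_mul, (ha _).1]
  · rw [← map_mul, mul_smul_comm, ← smul_mul_assoc, map_mul, (ha _).2]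

theorem factorsThroughUltraproducts_of_isCardComplete {f : (∀ i, A i) →ₙₐ[R] B} {κ : Cardinal.{u}}
    (hfin : {U : Ultrafilter I | (U : Filter I) ≤ vanishingFilter (quotLinearMap f)}.Finite)
    (hc : ∀ U : Ultrafilter I, (U : Filter I) ≤ vanishingFilter (quotLinearMap f) →
      (U : Filter I).IsCardComplete κ) : FactorsThroughUltraproducts f κ := by
  obtain ⟨n, U, hinj, hrange⟩ := hfin.fin_param
  refine ⟨n, U, fun m => hc _ (hrange.subset ⟨m, rfl⟩), ?_⟩
  refine exists_nonUnitalAlgHom_factor (g := (totalAnnihilator R B).quotMk.comp f)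
    (Ultraproduct.piLift_mk_surjective hinj) fun a ha => ?_
  have hzero : {i | a i = 0} ∈ vanishingFilter (quotLinearMap f) :=
    mem_iff_ultrafilter.2 fun V hV => by
      obtain ⟨m, rfl⟩ := hrange.superset hV
      exact Ultraproduct.mk_eq_zero_iff.1 (congrFun ha m)
  exact mem_vanishingFilter.1 hzero a fun i hi => hi

theorem splitsOverFiniteSubproduct_of_mem {f : (∀ i, A i) →ₙₐ[R] B} {J : Finset I}
    (hJ : (J : Set I) ∈ vanishingFilter (quotLinearMap f)) : SplitsOverFiniteSubproduct f := by
  let proj : (∀ i, A i) →ₙₐ[R] ∀ i : J, A i := piLift fun i : J => piEval i.1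
  have hproj : Function.Surjective proj := Subtype.surjective_restrict (· ∈ J)
  have hker : ∀ a, proj a = 0 → ∀ i ∈ J, a i = 0 := fun a ha i hi => congrFun ha ⟨i, hi⟩
  have hcompl : ∀ a, f (piIndicator (R := R) (J : Set I)ᶜ a) ∈ totalAnnihilatorSubalgebra R B :=
    fun a => AlgIdeal.quotMk_eq_zero_iff.1
      (hJ _ fun i hi => piIndicator_apply_of_notMem a (Set.notMem_compl_iff.2 hi))
  have hsum : ∀ a, f a =
      f (piIndicator (R := R) (J : Set I) a) + f (piIndicator (R := R) (J : Set I)ᶜ a) :=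
    fun a => by rw [← map_add, piIndicator_add_piIndicator_compl]
  refine ⟨J, exists_nonUnitalAlgHom_factor (g := (totalAnnihilator R B).quotMk.comp f) hproj
      fun a ha => hJ a (hker a ha),
    f.comp (piIndicator J),
    NonUnitalAlgHom.codRestrict (f.comp (piIndicator (J : Set I)ᶜ)) _ hcompl,
    exists_nonUnitalAlgHom_factor hproj fun a ha => ?_, hsum⟩
  have hzero : piIndicator (R := R) (J : Set I) a = 0 := funext fun i => by
    by_cases hi : i ∈ J
    · exact (piIndicator_apply_of_mem a hi).trans (hker a ha i hi)
    · exact piIndicator_apply_of_notMem a hi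
  rw [NonUnitalAlgHom.comp_apply, hzero, map_zero]

theorem factors_and_splits_of_hasUnitKernel [∀ i, IsScalarTower R (A i) (A i)]
    [∀ i, SMulCommClass R (A i) (A i)] {f : (∀ i, A i) →ₙₐ[R] B} (hf : Function.Surjective f)
    {κ : Cardinal.{u}} (hκ : ℵ₀ ≤ κ)
    (hker : ∀ T : Type v, Cardinal.lift.{u} #T ≤ Cardinal.lift.{v} κ →
      HasUnitKernel R (totalAnnihilator R B).Quot T) :
    FactorsThroughUltraproducts f (Order.succ κ) ∧
      ((∀ μ : Cardinal.{v}, μ.IsMeasurableCard →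
          Cardinal.lift.{v} κ < Cardinal.lift.{u} μ → #I < μ) →
        SplitsOverFiniteSubproduct f) := by
  have hstable : ∀ a, quotLinearMap f a = 0 → ∀ s : I → R, quotLinearMap f (s • a) = 0 :=
    fun _ => quotLinearMap_smul_eq_zero hf
  have hnat : HasUnitKernel R (totalAnnihilator R B).Quot ℕ :=
    (hker (ULift.{v} ℕ) (by simpa using hκ)).of_injective ULift.up_injective
  have hfin := finite_ultrafilters_le_vanishingFilter hstable hnat
  have hcomp : ∀ U : Ultrafilter I, (U : Filter I) ≤ vanishingFilter (quotLinearMap f) →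
      (U : Filter I).IsCardComplete (Order.succ κ) := fun U hU =>
    isCardComplete_of_le_vanishingFilter hstable hfin
      (fun T hT => hker T (by rwa [Cardinal.lift_succ, Order.lt_succ_iff] at hT)) hU
  refine ⟨factorsThroughUltraproducts_of_isCardComplete hfin hcomp, fun hμ => ?_⟩
  have hprincipal : ∀ U : Ultrafilter I, (U : Filter I) ≤ vanishingFilter (quotLinearMap f) →
      ∃ i, U = pure i := fun U hU => by
    refine U.le_cofinite_or_eq_pure.resolve_left fun hU' => ?_
    obtain ⟨μ, hmeas, hlt, hle⟩ := exists_isMeasurableCard_of_isCardComplete hU' hκ (hcomp U hU)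
    exact (hμ μ hmeas hlt).not_ge hle
  have hJ : {i | (pure i : Filter I) ≤ vanishingFilter (quotLinearMap f)}.Finite :=
    hfin.preimage (f := (pure : I → Ultrafilter I)) Ultrafilter.pure_injective.injOn
  refine splitsOverFiniteSubproduct_of_mem (J := hJ.toFinset) (mem_iff_ultrafilter.2 fun U hU => ?_)
  obtain ⟨i, rfl⟩ := hprincipal U hU
  simpa using hU

end Quotient

theorem theorem3p2
    {R : Type u} [CommRing R] [IsDomain R] [ValuationRing R]
    [Infinite (IsLocalRing.ResidueField R)]
    {I : Type v} {A : I → Type w}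
    [∀ i, NonUnitalNonAssocRing (A i)] [∀ i, Module R (A i)]
    [∀ i, IsScalarTower R (A i) (A i)] [∀ i, SMulCommClass R (A i) (A i)]
    {B : Type x} [NonUnitalNonAssocRing B] [Module R B]
    [IsScalarTower R B B] [SMulCommClass R B B] [Module.IsTorsionFree R B]
    (f : (∀ i, A i) →ₙₐ[R] B) (hf : Function.Surjective f) :
    (Cardinal.lift.{u} (Module.rank R B) < Cardinal.lift.{x} #(IsLocalRing.ResidueField R) →
      FactorsThroughUltraproducts f (Order.succ #(IsLocalRing.ResidueField R)) ∧
      ((∀ μ : Cardinal.{v}, μ.IsMeasurableCard →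
          Cardinal.lift.{v} #(IsLocalRing.ResidueField R) < Cardinal.lift.{u} μ → #I < μ) →
        SplitsOverFiniteSubproduct f)) ∧
    (Module.rank R B < 2 ^ ℵ₀ →
      FactorsThroughUltraproducts f ℵ₁ ∧
      ((∀ μ : Cardinal.{v}, μ.IsMeasurableCard → ℵ₀ < μ → #I < μ) →
        SplitsOverFiniteSubproduct f)) := by
  have hQ := rank_quotient_le (totalAnnihilator R B).toSubmodule
  refine ⟨fun hrank => ?_, fun hrank => ?_⟩
  · refine factors_and_splits_of_hasUnitKernel hf (Cardinal.aleph0_le_mk _) fun T hT => ?_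
    exact hasUnitKernel_of_rank_lt_mk ((Cardinal.lift_le.2 hQ).trans_lt hrank) hT
  · have hnat : HasUnitKernel R (totalAnnihilator R B).Quot ℕ :=
      hasUnitKernel_nat_of_rank_lt (hQ.trans_lt hrank)
    have := factors_and_splits_of_hasUnitKernel hf le_rfl fun T hT => by
      have : Countable T := Cardinal.mk_le_aleph0_iff.1 (by simpa using hT)
      exact hnat.of_injective (exists_injective_nat T).choose_spec
    simpa [Cardinal.succ_aleph0] using this
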